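/- For $n \ge 0$ let $B_n \subset \mathbb{R}^n$ be the root system consisting of the vectors $\pm e_i$ ($1 \le i \le n$) and $\pm e_i \pm e_j$ ($1 \le i < j \le n$), with the standard base $e_1 - e_2, \ldots, e_{n-1} - e_n, e_n$; $B_n^+$ denotes its positive roots, that is, the roots that are combinations of the base with non-negative integer coefficients ($B_0$ is the empty root system of rank $0$). A subset $\Phi \subseteq B_n^+$ is an inversion set if it is closed ($\alpha, \beta \in \Phi$ and $\alpha + \beta \in B_n^+$ imply $\alpha + \beta \in \Phi$) and its complement $B_n^+ \setminus \Phi$ is closed in the same sense. A fine decomposition of $B_n$ is an unordered collection of exactly $n = \operatorname{rk} B_n$ non-empty, pairwise disjoint inversion sets whose union is $B_n^+$. Let $b_n$ be the number of fine decompositions of $B_n$, and let $a_k = \frac{1}{k+1}\binom{2k}{k}$ be the $k$-th Catalan number. Then $b_0 = 1$ and, for every $n \ge 1$, \[ b_n = b_{n-1} + 2 \sum_{i=2}^{n} a_{i-1}\, b_{n-i}. \] The values $b_1, \ldots, b_7$ are $1, 3, 9, 29, 97, 333, 1165$. -/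

import Mathlib

namespace FineDecomposition

section General

variable {E : Type*} [AddCommGroup E]

/-- The positive roots of the set of roots `R` with respect to the base `θ`: the roots all of whose
coefficients in the base are non-negative integers. -/
def posRoots {ι : Type*} [Fintype ι] (R : Set E) (θ : ι → E) : Set E :=
  {α | α ∈ R ∧ ∃ d : ι → ℕ, α = ∑ i, d i • θ i}

/-- A set `Φ` of positive roots is closed (relative to the set `P` of all positive roots) if a sum
of two elements of `Φ` lies in `Φ` as soon as it is a positive root. -/
def IsClosedIn (P Φ : Set E) : Prop :=
  ∀ α ∈ Φ, ∀ β ∈ Φ, α + β ∈ P → α + β ∈ Φ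

/-- An inversion set in the set `P` of positive roots: a subset of `P` that is closed and
co-closed (its complement in `P` is closed). -/
structure IsInversionSet (P Φ : Set E) : Prop where
  subset : Φ ⊆ P
  closed : IsClosedIn P Φ
  coclosed : IsClosedIn P (P \ Φ)

/-- A decomposition of `Φ`: an (unordered) collection of non-empty, pairwise disjoint inversion
sets whose union is `Φ`. -/
structure IsDecomposition (P Φ : Set E) (D : Set (Set E)) : Prop where
  inversion : ∀ Ψ ∈ D, IsInversionSet P Ψ
  nonempty : ∀ Ψ ∈ D, Ψ.Nonempty
  disjoint : ∀ Ψ ∈ D, ∀ Ψ' ∈ D, Ψ ≠ Ψ' → Disjoint Ψ Ψ'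
  union : ⋃₀ D = Φ

end General

/-- A fine decomposition of a root system (with roots spanning `E` and with positive roots `P`):
a decomposition of `P` into as many inversion sets as the rank, that is, the dimension of `E`. -/
structure IsFineDecomposition {E : Type*} [AddCommGroup E] [Module ℝ E]
    (P : Set E) (D : Set (Set E)) : Prop where
  decomposition : IsDecomposition P P D
  card : D.ncard = Module.finrank ℝ E

/-- The number of fine decompositions of the root system in `E` with positive roots `P`. -/
noncomputable def numFine {E : Type*} [AddCommGroup E] [Module ℝ E] (P : Set E) : ℕ :=
  {D : Set (Set E) | IsFineDecomposition P D}.ncard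

/-- The `i`-th standard unit vector of Euclidean `n`-space. -/
noncomputable def stdVec {n : ℕ} (i : Fin n) : EuclideanSpace ℝ (Fin n) :=
  EuclideanSpace.single i 1

/-- The root system `B_n`: the vectors `± e_i`, and the vectors `± e_i ± e_j` with `i ≠ j`. -/
def rootsB (n : ℕ) : Set (EuclideanSpace ℝ (Fin n)) :=
  {α | (∃ i, α = stdVec i ∨ α = -stdVec i) ∨
    ∃ i j, i ≠ j ∧
      (α = stdVec i + stdVec j ∨ α = stdVec i - stdVec j ∨ α = -stdVec i - stdVec j)}

/-- The standard base of `B_n`: `e_1 - e_2, …, e_{n-1} - e_n, e_n` (indices in `Fin n` start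
at `0`). -/
noncomputable def simpleB (n : ℕ) (i : Fin n) : EuclideanSpace ℝ (Fin n) :=
  if h : (i : ℕ) + 1 < n then stdVec i - stdVec ⟨(i : ℕ) + 1, h⟩ else stdVec i

/-- `b_n`, the number of fine decompositions of the root system `B_n`. -/
noncomputable def b (n : ℕ) : ℕ :=
  numFine (posRoots (rootsB n) (simpleB n))

end FineDecomposition

namespace FineDecomposition

/-! The complement of a part of a decomposition is closed, and the base generates all positive roots
under root sums, so every part contains a simple root. With as many parts as simple roots, each part
contains exactly one. A fine decomposition is thus the same as a colouring of the positive roots in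
which simple roots have their own index as colour and a root that is a sum of two positive roots has
the colour of one of them (`numFine_eq_card_rootColouring`).

In type A the roots are intervals. If the whole interval has colour `r`, so does every interval
containing `[r, r + 1]`, while the colours to its left and to its right are independent. This is the
Catalan recursion (`finite_and_card_intervalColouring`).

In type B let `t` be the colour of the highest short root. Either every root whose support contains
the `t`-th simple root has colour `t`; put `s = t`. Or some such root has another colour; then let
`s > t` be the colour of `e_{t+1}`, and the roots whose support contains the `s`-th simple root have
colour `t` or `s` by a rule that depends only on `t` and `s` (`IsSignedColouring.exists_glue`). What
remains free is a type A colouring to the left of `s`, which in the second case determines `t`, and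
a type B colouring to the right. Conversely all such data glue to a colouring. Hence `s` contributes
a Catalan number times a smaller `b`, once if `s` is the first index and twice otherwise. -/

/-! ### Type A: interval colourings and Catalan numbers -/

/-- Colourings of the intervals `[i, j]` with `m ≤ i < j ≤ s` by natural numbers such that the
unit interval `[i, i + 1]` has colour `i`, and the colour of an interval that is cut into two is
the colour of one of the two parts. The values outside the range are `0`. -/
structure IsIntervalColouring (m s : ℕ) (p : ℕ → ℕ → ℕ) : Prop where
  supp : ∀ i j, ¬ (m ≤ i ∧ i < j ∧ j ≤ s) → p i j = 0
  simple : ∀ i, m ≤ i → i < s → p i (i + 1) = i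
  split : ∀ i j k, m ≤ i → i < j → j < k → k ≤ s → p i k = p i j ∨ p i k = p j k

namespace IsIntervalColouring

variable {m s : ℕ} {p : ℕ → ℕ → ℕ}

/-- Induction on the length: cutting off the first unit interval leaves either its colour `i` or the
colour of the shorter interval. -/
theorem bounds (h : IsIntervalColouring m s p) {i j : ℕ} (hi : m ≤ i) (hij : i < j)
    (hj : j ≤ s) : i ≤ p i j ∧ p i j < j := by
  obtain ⟨d, rfl⟩ : ∃ d, j = i + 1 + d := ⟨j - (i + 1), by omega⟩
  clear hij
  induction d generalizing i with
  | zero => have := h.simple i hi (by omega); simp_all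
  | succ d ih =>
    have h1 := h.simple i hi (by omega)
    have h2 := @ih (i + 1) (by omega) (by omega)
    have e : i + 1 + 1 + d = i + 1 + (d + 1) := by omega
    rw [e] at h2
    have h3 := h.split i (i + 1) (i + 1 + (d + 1)) hi (by omega) (by omega) hj
    omega

/-- Trimming `[a, b]` on the left removes an interval whose colours are all less than `i`, so by
`bounds` the colour `p a b` must survive in the remaining part; likewise on the right. -/
theorem eq_of_mem (h : IsIntervalColouring m s p) {a b i j : ℕ} (ha : m ≤ a) (hb : b ≤ s)
    (hai : a ≤ i) (hi : i ≤ p a b) (hj : p a b < j) (hjb : j ≤ b) : p i j = p a b := by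
  have h1 : p i b = p a b := by
    rcases hai.eq_or_lt with rfl | hai
    · rfl
    · have := h.split a i b ha hai (by omega) hb
      have := h.bounds ha hai (by omega)
      omega
  rcases hjb.eq_or_lt with rfl | hjb
  · exact h1
  · have := h.split i j b (by omega) (by omega) hjb hb
    have := h.bounds (i := j) (j := b) (by omega) hjb hb
    omega

/-- The restriction of a colouring to a smaller range. -/
theorem restrict (h : IsIntervalColouring m s p) {m' s' : ℕ} (hm : m ≤ m') (hs : s' ≤ s) :
    IsIntervalColouring m' s' (fun i j => if m' ≤ i ∧ i < j ∧ j ≤ s' then p i j else 0) where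
  supp i j hij := if_neg hij
  simple i hi hs' := by
    rw [if_pos (by omega)]
    exact h.simple i (by omega) (by omega)
  split i j k hi hij hjk hk := by
    rw [if_pos (by omega), if_pos (by omega), if_pos (by omega)]
    exact h.split i j k (by omega) hij hjk (by omega)

theorem ext_of_eq {q : ℕ → ℕ → ℕ} (hp : IsIntervalColouring m s p)
    (hq : IsIntervalColouring m s q)
    (h : ∀ i j, m ≤ i → i < j → j ≤ s → p i j = q i j) : p = q := by
  funext i j
  by_cases hij : m ≤ i ∧ i < j ∧ j ≤ s
  · exact h i j hij.1 hij.2.1 hij.2.2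
  · rw [hp.supp i j hij, hq.supp i j hij]

end IsIntervalColouring

/-- The colouring in which all intervals around `[r, r + 1]` have colour `r`, and the intervals
to the left and right are coloured by `p` and `q`. -/
def glueInterval (m s r : ℕ) (p q : ℕ → ℕ → ℕ) (i j : ℕ) : ℕ :=
  if j ≤ r then p i j else if r < i then q i j else if m ≤ i ∧ j ≤ s then r else 0

/-- Wherever an interval around `[r, r + 1]` is cut, one of the two parts still contains `[r, r +
1]`. -/
theorem isIntervalColouring_glueInterval {m s r : ℕ} {p q : ℕ → ℕ → ℕ} (hm : m ≤ r) (hr : r < s)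
    (hp : IsIntervalColouring m r p) (hq : IsIntervalColouring (r + 1) s q) :
    IsIntervalColouring m s (glueInterval m s r p q) where
  supp i j hij := by
    have := hp.supp i j
    have := hq.supp i j
    unfold glueInterval
    split_ifs <;> grind
  simple i hi his := by
    have := hp.simple i
    have := hq.simple i
    unfold glueInterval
    split_ifs <;> grind
  split i j k hi hij hjk hk := by
    have := hp.split i j k
    have := hq.split i j k
    unfold glueInterval
    split_ifs <;> grind

/-- The type of colourings of intervals in `[m, s]`. -/
abbrev IntervalColouring (m s : ℕ) : Type := {p : ℕ → ℕ → ℕ // IsIntervalColouring m s p}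

/-- Gluing two colourings of intervals at a unit interval. -/
def IntervalColouring.glue (m d : ℕ) :
    (Σ x : Fin (d + 1), IntervalColouring m (m + x) × IntervalColouring (m + x + 1) (m + d + 1)) →
      IntervalColouring m (m + d + 1) :=
  fun x => ⟨glueInterval m (m + d + 1) (m + x.1) x.2.1.1 x.2.2.1,
    isIntervalColouring_glueInterval (by omega) (by omega) x.2.1.2 x.2.2.2⟩

theorem IntervalColouring.glue_bijective (m d : ℕ) :
    Function.Bijective (IntervalColouring.glue m d) := by
  constructor
  · rintro ⟨x, ⟨p, hp⟩, ⟨q, hq⟩⟩ ⟨y, ⟨p', hp'⟩, ⟨q', hq'⟩⟩ h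
    have h : glueInterval m (m + d + 1) (m + x) p q = glueInterval m (m + d + 1) (m + y) p' q' :=
      congrArg Subtype.val h
    have hxy : x = y := by
      have := congrFun (congrFun h m) (m + d + 1)
      unfold glueInterval at this
      grind
    subst hxy
    have e1 : p = p' := hp.ext_of_eq hp' fun i j _ _ _ => by
      have := congrFun (congrFun h i) j
      unfold glueInterval at this
      grind
    have e2 : q = q' := hq.ext_of_eq hq' fun i j _ _ _ => by
      have := congrFun (congrFun h i) j
      unfold glueInterval at this
      grind
    subst e1 e2
    rfl
  · rintro ⟨p, hp⟩
    have hb := hp.bounds (i := m) (j := m + d + 1) le_rfl (by omega) le_rfl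
    obtain ⟨x, hx⟩ : ∃ x, p m (m + d + 1) = m + x := ⟨p m (m + d + 1) - m, by omega⟩
    refine ⟨⟨⟨x, by omega⟩, ⟨_, hp.restrict le_rfl (by simp; omega)⟩,
      ⟨_, hp.restrict (by simp; omega) le_rfl⟩⟩, Subtype.ext ?_⟩
    refine (isIntervalColouring_glueInterval (by omega) (by simp; omega)
      (hp.restrict le_rfl (by simp; omega)) (hp.restrict (by simp; omega) le_rfl)).ext_of_eq hp ?_
    intro i j hi hij hj
    have := hp.eq_of_mem (a := m) (b := m + d + 1) (i := i) (j := j) le_rfl le_rfl hi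
    simp only [glueInterval]
    split_ifs <;> grind

theorem finite_and_card_intervalColouring (d : ℕ) : ∀ m : ℕ,
    Finite (IntervalColouring m (m + d)) ∧ Nat.card (IntervalColouring m (m + d)) = catalan d := by
  induction d using Nat.strong_induction_on with
  | _ d ih =>
    intro m
    cases d with
    | zero =>
      have : Unique (IntervalColouring m (m + 0)) :=
        { default := ⟨fun _ _ => 0, fun _ _ _ => rfl, fun _ _ _ => by omega, by simp⟩
          uniq := fun p => Subtype.ext (by
            funext i j
            exact p.2.supp i j (by omega)) }
      exact ⟨inferInstance, by simp⟩
    | succ d =>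
      have h1 (x : Fin (d + 1)) := ih x x.2 m
      have h2 (x : Fin (d + 1)) := ih (d - x) (by omega) (m + x + 1)
      have e (x : Fin (d + 1)) : m + x + 1 + (d - x) = m + d + 1 := by omega
      simp only [e] at h2
      have f1 (x : Fin (d + 1)) := (h1 x).1
      have f2 (x : Fin (d + 1)) := (h2 x).1
      have g := Equiv.ofBijective _ (IntervalColouring.glue_bijective m d)
      refine ⟨Finite.of_equiv _ g, ?_⟩
      rw [show m + (d + 1) = m + d + 1 from rfl, ← Nat.card_congr g, Nat.card_sigma, catalan_succ]
      refine Finset.sum_congr rfl fun x _ => ?_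
      rw [Nat.card_prod, (h1 x).2, (h2 x).2]

/-! ### Type B: signed colourings and their structure -/

/-- Colourings of the positive roots of the root system of type `B` on the indices `m, …, n - 1`:
`u i j` is the colour of `e_i - e_j` for `j < n`, `u i n` is the colour of `e_i`, and `v i j` is
the colour of `e_i + e_j`. -/
structure IsSignedColouring (m n : ℕ) (u v : ℕ → ℕ → ℕ) : Prop where
  interval : IsIntervalColouring m n u
  supp : ∀ i j, ¬ (m ≤ i ∧ i < n ∧ m ≤ j ∧ j < n ∧ i ≠ j) → v i j = 0
  symm : ∀ i j, v i j = v j i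
  short : ∀ i j, m ≤ i → i < n → m ≤ j → j < n → i ≠ j → v i j = u i n ∨ v i j = u j n
  long : ∀ i j k, m ≤ i → i < k → k < n → m ≤ j → j < n → j ≠ i → j ≠ k →
    v i j = u i k ∨ v i j = v k j

namespace IsSignedColouring

variable {m n : ℕ} {u v : ℕ → ℕ → ℕ}

/-- The restriction of a colouring to the indices from `m'` on. -/
theorem restrict (h : IsSignedColouring m n u v) {m' : ℕ} (hm : m ≤ m') :
    IsSignedColouring m' n (fun i j => if m' ≤ i ∧ i < j ∧ j ≤ n then u i j else 0)
      (fun i j => if m' ≤ i ∧ i < n ∧ m' ≤ j ∧ j < n ∧ i ≠ j then v i j else 0) where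
  interval := h.interval.restrict hm le_rfl
  supp i j hij := if_neg hij
  symm i j := by
    have := h.symm i j
    split_ifs <;> grind
  short i j hi hin hj hjn hij := by
    have := h.short i j
    split_ifs <;> grind
  long i j k hi hik hk hj hjn hji hjk := by
    have := h.long i j k
    split_ifs <;> grind

theorem ext_of_eq {u' v' : ℕ → ℕ → ℕ} (h : IsSignedColouring m n u v)
    (h' : IsSignedColouring m n u' v')
    (e : ∀ i j, m ≤ i → i < j → j ≤ n → u i j = u' i j)
    (e' : ∀ i j, m ≤ i → i < j → j < n → v i j = v' i j) : u = u' ∧ v = v' := by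
  refine ⟨h.interval.ext_of_eq h'.interval e, ?_⟩
  funext i j
  by_cases hij : m ≤ i ∧ i < n ∧ m ≤ j ∧ j < n ∧ i ≠ j
  · rcases hij.2.2.2.2.lt_or_gt with hlt | hlt
    · exact e' i j (by omega) hlt (by omega)
    · rw [h.symm, h'.symm]
      exact e' j i (by omega) hlt (by omega)
  · rw [h.supp i j hij, h'.supp i j hij]

end IsSignedColouring

/-- The colours of the short roots `e_i` with `i ≤ s` in a colouring glued at `s`. -/
def glueShort (m s : ℕ) (ε : Bool) (p : ℕ → ℕ → ℕ) (i : ℕ) : ℕ :=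
  if ε = true ∧ i ≤ p m s then p m s else s

/-- The colours of the `e_i - e_j` and `e_i` in a colouring glued at `s`. -/
def glueMinus (m s n : ℕ) (f : ℕ → ℕ) (p u : ℕ → ℕ → ℕ) (i j : ℕ) : ℕ :=
  if j ≤ s then p i j else if s < i then u i j else if m ≤ i ∧ j ≤ n then f i else 0

/-- The colours of the `e_i + e_j` in a colouring glued at `s`. -/
def gluePlus (m s n : ℕ) (f : ℕ → ℕ) (v : ℕ → ℕ → ℕ) (i j : ℕ) : ℕ :=
  if s < i ∧ s < j then v i j else if m ≤ i ∧ i < n ∧ m ≤ j ∧ j < n ∧ i ≠ j then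
    (if i ≤ s ∧ j ≤ s then f (max i j) else f (min i j)) else 0

/-- Here `f i` colours `e_i` for `i ≤ s`. Condition `hf` is what the splittings `e_j = (e_j - e_k) +
e_k` (case `i = j`) and `e_i + e_j = (e_i - e_k) + (e_k + e_j)` demand when all indices are at most
`s`, since there `e_i + e_j` has colour `f (max i j)`. -/
theorem isSignedColouring_glue {m s n : ℕ} {f : ℕ → ℕ} {p u v : ℕ → ℕ → ℕ}
    (hm : m ≤ s) (hs : s < n) (hp : IsIntervalColouring m s p)
    (huv : IsSignedColouring (s + 1) n u v) (hfs : f s = s)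
    (hf : ∀ i j k, m ≤ i → i ≤ j → j < k → k ≤ s → f j = f k ∨ p i k = f j) :
    IsSignedColouring m n (glueMinus m s n f p u) (gluePlus m s n f v) where
  interval :=
    { supp i j hij := by
        have := hp.supp i j
        have := huv.interval.supp i j
        unfold glueMinus
        split_ifs <;> grind
      simple i hi his := by
        have := hp.simple i
        have := huv.interval.simple i
        unfold glueMinus
        split_ifs <;> grind
      split i j k hi hij hjk hk := by
        have := hp.split i j k
        have := huv.interval.split i j k
        have := hf i i j
        unfold glueMinus
        split_ifs <;> grind }
  supp i j hij := by
    have := huv.supp i j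
    unfold gluePlus
    split_ifs <;> grind
  symm i j := by
    have := huv.symm i j
    unfold gluePlus
    rw [max_comm, min_comm]
    split_ifs <;> grind
  short i j hi hin hj hjn hij := by
    have := huv.short i j
    unfold gluePlus glueMinus
    split_ifs <;> grind
  long i j k hi hik hk hj hjn hji hjk := by
    have := huv.long i j k
    have := hf i (max i j) k
    have := hf i i k
    by_cases h1 : i ≤ s <;> by_cases h2 : j ≤ s <;> by_cases h3 : k ≤ s <;>
    simp only [gluePlus, glueMinus, ← not_le, h1, h2, h3] <;> grind

/-- If `f j ≠ f k` with `j < k`, then `j ≤ t < k` for `t = p m s`, so the interval `[i, k]` contains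
`[t, t + 1]` and has colour `t = f j` by `eq_of_mem`. For `m = s` there is no such `t` (`p m m` is a
default value), which is why `ε = true` requires `m < s`. -/
theorem glueShort_spec {m s : ℕ} (ε : Bool) {p : ℕ → ℕ → ℕ} (hp : IsIntervalColouring m s p)
    (hε : ε = true → m < s) : glueShort m s ε p s = s ∧ ∀ i j k, m ≤ i → i ≤ j → j < k → k ≤ s →
      glueShort m s ε p j = glueShort m s ε p k ∨ p i k = glueShort m s ε p j := by
  cases ε with
  | false => simp [glueShort]
  | true =>
    have := hp.bounds le_rfl (hε rfl) le_rfl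
    refine ⟨by simp only [glueShort]; grind, fun i j k hi hij hjk hk => ?_⟩
    have := hp.eq_of_mem (a := m) (b := s) (i := i) (j := k) le_rfl le_rfl hi
    simp only [glueShort]
    grind

/-- A colouring is glued at the colour of the highest short root if all roots around the
corresponding simple root have this colour, and else at a larger index. -/
theorem IsSignedColouring.exists_glue {m n : ℕ} {u v : ℕ → ℕ → ℕ}
    (h : IsSignedColouring m n u v) (hmn : m < n) :
    ∃ (s : ℕ) (ε : Bool), m ≤ s ∧ s < n ∧ (ε = true → m < s) ∧
      ∀ p, IsIntervalColouring m s p → (∀ i j, m ≤ i → i < j → j ≤ s → p i j = u i j) →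
      (∀ i k, m ≤ i → i ≤ s → s < k → k ≤ n → u i k = glueShort m s ε p i) ∧
      (∀ i k, m ≤ i → i ≤ s → s < k → k < n → v i k = glueShort m s ε p i) ∧
      (∀ i j, m ≤ i → i < j → j ≤ s → v i j = glueShort m s ε p j) := by
  obtain ⟨t, ht⟩ : ∃ t, u m n = t := ⟨_, rfl⟩
  have htb := h.interval.bounds (i := m) (j := n) le_rfl hmn le_rfl
  have hut (i j : ℕ) (hi : m ≤ i) (hit : i ≤ t) (htj : t < j) (hj : j ≤ n) : u i j = t := by
    rw [← ht]
    exact h.interval.eq_of_mem le_rfl le_rfl hi (by omega) (by omega) hj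
  have hvt (i j : ℕ) (hi : m ≤ i) (hij : i < j) (hj : j ≤ t) : v i j = t := by
    have := h.short i j hi (by omega) (by omega) (by omega) (by omega)
    have := hut i n
    have := hut j n
    omega
  -- A single deviation spreads: if `e_i + e_j` with `i ≤ t < j` lacks colour `t`, it has the colour
  -- of `e_j`, which is at least `j`. For `k ≠ i`, splitting off `e_k - e_i` or `e_i - e_k` forces
  -- this colour on `e_k + e_j`, as the colour of the difference is either too small or equal to
  -- `t`.
  have hprop (i j : ℕ) (hi : m ≤ i) (hit : i ≤ t) (hj : t < j) (hjn : j < n) (hv : v i j ≠ t)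
      (k : ℕ) (hk : m ≤ k) (hkn : k < n) (hkj : k ≠ j) : v k j = u j n := by
    have e : v i j = u j n := by
      have := h.short i j hi (by omega) (by omega) (by omega) (by omega)
      have := hut i n
      omega
    rcases lt_trichotomy k i with hki | rfl | hki
    · have h1 := h.long k j i hk hki (by omega) (by omega) hjn (by omega) (by omega)
      have h2 := h.short k j hk (by omega) (by omega) hjn (by omega)
      have h3 := hut k n hk
      have h4 := h.interval.bounds hk hki (by omega)
      omega
    · exact e
    · have h1 := h.long i j k hi hki hkn (by omega) hjn (by omega) (by omega)
      have h2 := h.interval.bounds hi hki (by omega)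
      have h3 := hut i k hi hit
      have h4 := h.interval.bounds (i := j) (j := n) (by omega) hjn le_rfl
      omega
  by_cases hsp : ∀ j, t < j → j < n → v t j = t
  · refine ⟨t, false, by omega, by omega, by simp, fun p hp hpu => ?_⟩
    simp only [glueShort, Bool.false_eq_true, false_and, if_false]
    refine ⟨fun i k hi hit hk hkn => hut i k hi hit hk hkn, fun i k hi hit hk hkn => ?_, hvt⟩
    by_contra hne
    have h1 := hprop i k hi hit hk hkn hne t (by omega) (by omega) (by omega)
    have h2 := hsp k hk hkn
    have h3 := h.interval.bounds (i := k) (j := n) (by omega) hkn le_rfl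
    omega
  · push Not at hsp
    obtain ⟨j, htj, hjn, hvj⟩ := hsp
    obtain ⟨s, hs⟩ : ∃ s, u (t + 1) n = s := ⟨_, rfl⟩
    have hsb := h.interval.bounds (i := t + 1) (j := n) (by omega) (by omega) le_rfl
    have hus (i k : ℕ) (hi : t < i) (his : i ≤ s) (hk : s < k) (hkn : k ≤ n) : u i k = s := by
      rw [← hs]
      exact h.interval.eq_of_mem (by omega) le_rfl hi (by omega) (by omega) hkn
    -- A deviation at some `j` implies one at `t + 1`: in `e_{t+1} + e_t = (e_{t+1} - e_j) + (e_j +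
    -- e_t)` the first summand has colour at least `t + 1`, the second a colour other than `t`.
    have hv1 : v t (t + 1) ≠ t := by
      rcases (Nat.succ_le_of_lt htj).eq_or_lt with rfl | htj'
      · exact hvj
      · have h1 := hprop t j (by omega) le_rfl htj hjn hvj (t + 1) (by omega) (by omega) (by omega)
        have h2 := h.symm t (t + 1)
        have h3 := h.long (t + 1) t j (by omega) htj' hjn (by omega) (by omega) (by omega) (by omega)
        have h4 := h.symm j t
        have h5 := h.interval.bounds (i := t + 1) (j := j) (by omega) htj' hjn.le
        omega
    have hvs1 := hprop t (t + 1) (by omega) le_rfl (by omega) (by omega) hv1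
    rw [hs] at hvs1
    -- The same splitting shows that every `j` with `t < j ≤ s` deviates: `e_t + e_{t+1}` has colour
    -- `s`, but `e_{t+1} - e_j` has a colour below `j ≤ s`, so `e_j + e_t` has colour `s`.
    have hvs (j : ℕ) (hj : t < j) (hjs : j ≤ s) (k : ℕ) (hk : m ≤ k) (hkn : k < n)
        (hkj : k ≠ j) : v k j = s := by
      have e := hus j n hj hjs (by omega) le_rfl
      rw [← e]
      rcases (Nat.succ_le_of_lt hj).eq_or_lt with rfl | hj'
      · rw [e]
        exact hvs1 k hk hkn hkj
      refine hprop t j (by omega) le_rfl hj (by omega) ?_ k hk hkn hkj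
      have h1 := h.long (t + 1) t j (by omega) hj' (by omega) (by omega) (by omega) (by omega)
        (by omega)
      have h2 := h.symm (t + 1) t
      have h3 := h.symm j t
      have h4 := hvs1 t (by omega) (by omega) (by omega)
      have h5 := h.interval.bounds (i := t + 1) (j := j) (by omega) hj' (by omega)
      omega
    refine ⟨s, true, by omega, by omega, fun _ => by omega, fun p hp hpu => ?_⟩
    have hpt : p m s = t := by rw [hpu m s le_rfl (by omega) le_rfl, hut] <;> omega
    simp only [glueShort, hpt, true_and]
    refine ⟨fun i k hi his hk hkn => ?_, fun i k hi his hk hkn => ?_, fun i j hi hij hjs => ?_⟩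
    · split_ifs with hit
      · exact hut i k hi hit (by omega) hkn
      · exact hus i k (by omega) his hk hkn
    · split_ifs with hit
      -- For `k > s` no deviation is possible: `e_{t+1} + e_k` would have the colour of `e_k`, at
      -- least `k`, but it has colour `s`.
      · by_contra hne
        have h1 := hprop i k hi hit (by omega) hkn hne (t + 1) (by omega) (by omega) (by omega)
        have h2 := hvs1 k (by omega) hkn (by omega)
        have h3 := h.symm k (t + 1)
        have h4 := h.interval.bounds (i := k) (j := n) (by omega) hkn le_rfl
        omega
      · rw [h.symm]
        exact hvs i (by omega) his k (by omega) hkn (by omega)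
    · split_ifs with hjt
      · exact hvt i j hi hij hjt
      · exact hvs j (by omega) hjs i hi (by omega) (by omega)

/-! ### The gluing bijection in type B -/

/-- The type of colourings of the positive roots of type `B` on the indices `m, …, n - 1`. -/
abbrev SignedColouring (m n : ℕ) : Type :=
  {c : (ℕ → ℕ → ℕ) × (ℕ → ℕ → ℕ) // IsSignedColouring m n c.1 c.2}

/-- The indices at which, and the ways in which, a colouring can be glued. -/
abbrev GlueIndex (d : ℕ) : Type := {x : Fin (d + 1) × Bool // x.2 = true → 0 < x.1.1}

/-- Gluing a colouring of type `A` and one of type `B` at a simple root. -/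
def SignedColouring.glue (m d : ℕ) :
    (Σ x : GlueIndex d, IntervalColouring m (m + x.1.1) ×
      SignedColouring (m + x.1.1 + 1) (m + d + 1)) → SignedColouring m (m + d + 1) :=
  fun x => ⟨(glueMinus m (m + x.1.1.1) (m + d + 1) (glueShort m (m + x.1.1.1) x.1.1.2 x.2.1.1)
      x.2.1.1 x.2.2.1.1, gluePlus m (m + x.1.1.1) (m + d + 1)
      (glueShort m (m + x.1.1.1) x.1.1.2 x.2.1.1) x.2.2.1.2),
    isSignedColouring_glue (by omega) (by omega) x.2.1.2 x.2.2.2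
      (glueShort_spec _ x.2.1.2 fun h => by have := x.1.2 h; omega).1
      (glueShort_spec _ x.2.1.2 fun h => by have := x.1.2 h; omega).2⟩

theorem SignedColouring.glue_injective (m d : ℕ) :
    Function.Injective (SignedColouring.glue m d) := by
  rintro ⟨⟨⟨x, ε⟩, hx⟩, ⟨p, hp⟩, ⟨⟨u, v⟩, h⟩⟩ ⟨⟨⟨y, ε'⟩, hy⟩, ⟨p', hp'⟩, ⟨⟨u', v'⟩, h'⟩⟩ e
  have e := congrArg Subtype.val e
  simp only [glue, Prod.mk.injEq] at e hx hy
  obtain ⟨e1, e2⟩ := e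
  have b1 := fun hm => hp.bounds (i := m) (j := m + x) le_rfl hm le_rfl
  have b2 := fun hm => hp'.bounds (i := m) (j := m + y) le_rfl hm le_rfl
  -- Let `t` be the colour of `e_m`. If `ε = true`, then `e_t + e_{t+1}` has colour `s > t`; if `ε =
  -- false`, then `s = t` and the value there is `t`, or the default `0` when `t + 1` is out of
  -- range. So these two values determine `ε` and `s`.
  have hxy : x = y ∧ ε = ε' := by
    have k1 := congrFun (congrFun e1 m) (m + d + 1)
    obtain ⟨t, ht⟩ : ∃ t, glueMinus m (m + x) (m + d + 1) (glueShort m (m + x) ε p) p u m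
      (m + d + 1) = t := ⟨_, rfl⟩
    rw [ht] at k1
    have k2 := congrFun (congrFun e2 t) (t + 1)
    unfold glueMinus at ht k1
    unfold gluePlus at k2
    cases ε <;> cases ε' <;> simp only [glueShort] at * <;> grind
  obtain ⟨rfl, rfl⟩ := hxy
  have e3 : p = p' := hp.ext_of_eq hp' fun i j _ _ _ => by
    have := congrFun (congrFun e1 i) j
    unfold glueMinus at this
    grind
  have e4 : u = u' ∧ v = v' := h.ext_of_eq h'
    (fun i j _ _ _ => by
      have := congrFun (congrFun e1 i) j
      unfold glueMinus at this
      grind)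
    (fun i j _ _ _ => by
      have := congrFun (congrFun e2 i) j
      unfold gluePlus at this
      grind)
  obtain ⟨rfl, rfl⟩ := e4
  subst e3
  rfl

theorem SignedColouring.glue_surjective (m d : ℕ) :
    Function.Surjective (SignedColouring.glue m d) := by
  rintro ⟨⟨u, v⟩, h⟩
  obtain ⟨s, ε, hm, hn, hε, hs⟩ := h.exists_glue (by omega)
  obtain ⟨x, rfl⟩ : ∃ x, s = m + x := ⟨s - m, by omega⟩
  have hp := h.interval.restrict (m' := m) (s' := m + x) le_rfl hn.le
  obtain ⟨h1, h2, h3⟩ := hs _ hp (by grind)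
  refine ⟨⟨⟨⟨⟨x, by omega⟩, ε⟩, fun hx => by have := hε hx; simp; omega⟩,
    ⟨_, hp⟩, ⟨⟨_, _⟩, h.restrict (m' := m + x + 1) (by omega)⟩⟩, Subtype.ext ?_⟩
  obtain ⟨hf1, hf2⟩ := glueShort_spec ε hp hε
  refine Prod.ext_iff.2 ((isSignedColouring_glue hm hn hp (h.restrict (by omega)) hf1
    hf2).ext_of_eq h ?_ ?_)
  · intro i j hi hij hj
    have := h1 i j
    simp only [glueMinus]
    generalize glueShort m (m + x) ε _ = f at *
    grind
  · intro i j hi hij hj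
    have := h2 i j
    have := h3 i j
    simp only [gluePlus]
    generalize glueShort m (m + x) ε _ = f at *
    grind

/-! ### Fine decompositions as root colourings -/

/-- The colourings of the set `P` of positive roots such that the colour of a simple root is its
index, and the colour of a sum of two positive roots is the colour of one of them. -/
structure IsRootColouring {E ι : Type*} [AddCommGroup E] (P : Set E) (θ : ι → P)
    (κ : P → ι) : Prop where
  simple : ∀ i, κ (θ i) = i
  add : ∀ α β γ : P, (γ : E) = α + β → κ γ = κ α ∨ κ γ = κ β

section

variable {E ι : Type*} {P : Set E}

/-- The set of roots of a given colour. -/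
def colourClass (κ : P → ι) (i : ι) : Set E := {α | ∃ h : α ∈ P, κ ⟨α, h⟩ = i}

theorem mem_colourClass {κ : P → ι} {i : ι} (α : P) : (α : E) ∈ colourClass κ i ↔ κ α = i :=
  ⟨fun ⟨_, h⟩ => h, fun h => ⟨α.2, h⟩⟩

variable [AddCommGroup E] {θ : ι → P}

theorem IsRootColouring.mem_colourClass_self {κ : P → ι} (h : IsRootColouring P θ κ) (i : ι) :
    (θ i : E) ∈ colourClass κ i := (mem_colourClass _).2 (h.simple i)

theorem IsRootColouring.isInversionSet {κ : P → ι} (h : IsRootColouring P θ κ) (i : ι) :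
    IsInversionSet P (colourClass κ i) where
  subset _ hα := hα.1
  closed := by
    rintro α ⟨hα, rfl⟩ β ⟨hβ, h'⟩ hαβ
    refine ⟨hαβ, ?_⟩
    rcases h.add ⟨α, hα⟩ ⟨β, hβ⟩ ⟨α + β, hαβ⟩ rfl with e | e
    · exact e
    · exact e.trans h'
  coclosed := by
    rintro α ⟨hα, hα'⟩ β ⟨hβ, hβ'⟩ hαβ
    refine ⟨hαβ, fun ⟨_, e'⟩ => ?_⟩
    rcases h.add ⟨α, hα⟩ ⟨β, hβ⟩ ⟨α + β, hαβ⟩ rfl with e | e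
    · exact hα' ⟨hα, e.symm.trans e'⟩
    · exact hβ' ⟨hβ, e.symm.trans e'⟩

theorem IsRootColouring.isDecomposition {κ : P → ι} (h : IsRootColouring P θ κ) :
    IsDecomposition P P (Set.range (colourClass κ)) where
  inversion := by
    rintro _ ⟨i, rfl⟩
    exact h.isInversionSet i
  nonempty := by
    rintro _ ⟨i, rfl⟩
    exact ⟨_, h.mem_colourClass_self i⟩
  disjoint := by
    rintro _ ⟨i, rfl⟩ _ ⟨j, rfl⟩ hij
    rw [Set.disjoint_left]
    rintro α ⟨hα, rfl⟩ ⟨_, rfl⟩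
    exact hij rfl
  union := by
    ext α
    simp only [Set.sUnion_range, Set.mem_iUnion]
    exact ⟨fun ⟨_, hα, _⟩ => hα, fun hα => ⟨κ ⟨α, hα⟩, hα, rfl⟩⟩

theorem IsRootColouring.colourClass_injective {κ : P → ι} (h : IsRootColouring P θ κ) :
    Function.Injective (colourClass κ) := by
  intro i j hij
  have := h.mem_colourClass_self i
  rw [hij, mem_colourClass, h.simple] at this
  exact this

/-- The colour of a class can be read off from the simple root in it, so the unordered collection of
classes determines the colouring. -/
theorem IsRootColouring.eq_of_range_eq {κ κ' : P → ι} (h : IsRootColouring P θ κ)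
    (h' : IsRootColouring P θ κ')
    (e : Set.range (colourClass κ) = Set.range (colourClass κ')) : κ = κ' := by
  funext α
  obtain ⟨j, hj⟩ : colourClass κ (κ α) ∈ Set.range (colourClass κ') := e ▸ ⟨_, rfl⟩
  have h1 : (α : E) ∈ colourClass κ' j := hj ▸ (mem_colourClass α).2 rfl
  have h2 : (θ (κ α) : E) ∈ colourClass κ' j := hj ▸ h.mem_colourClass_self _
  rw [mem_colourClass] at h1 h2
  rw [h1, ← h2, h'.simple]

theorem IsDecomposition.exists_rootColouring [Finite ι] {D : Set (Set E)}
    (hD : IsDecomposition P P D) (hcard : D.ncard = Nat.card ι)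
    (hgen : ∀ S : Set E, (∀ i, (θ i : E) ∈ S) → IsClosedIn P S → P ⊆ S) :
    ∃ κ : P → ι, IsRootColouring P θ κ ∧ Set.range (colourClass κ) = D := by
  have hex (α : P) : ∃ Ψ : D, (α : E) ∈ (Ψ : Set E) := by
    obtain ⟨Ψ, h, h'⟩ := hD.union.ge α.2
    exact ⟨⟨Ψ, h⟩, h'⟩
  choose cls hcls using hex
  have huniq (α : P) (Ψ : D) (h : (α : E) ∈ (Ψ : Set E)) : cls α = Ψ := by
    by_contra hne
    exact Set.disjoint_left.1 (hD.disjoint _ (cls α).2 _ Ψ.2 fun e => hne (Subtype.ext e))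
      (hcls α) h
  -- A part without simple roots has a closed complement containing the base, hence all of `P`, so
  -- it would be empty.
  have hsurj : Function.Surjective fun i => cls (θ i) := by
    intro Ψ
    by_contra! hne
    obtain ⟨α, hα⟩ := hD.nonempty _ Ψ.2
    have hinv := hD.inversion _ Ψ.2
    refine (hgen (P \ Ψ) (fun i => ⟨(θ i).2, fun hi => hne i (huniq _ _ hi)⟩) hinv.coclosed
      (hinv.subset hα)).2 hα
  have hbij : Function.Bijective fun i => cls (θ i) :=
    hsurj.bijective_of_nat_card_le (by rw [Nat.card_coe_set_eq, hcard])
  let e := Equiv.ofBijective _ hbij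
  have he (α : P) (i : ι) : e.symm (cls α) = i ↔ (α : E) ∈ (e i : Set E) := by
    rw [Equiv.symm_apply_eq]
    exact ⟨fun h => h ▸ hcls α, fun h => huniq _ _ h⟩
  refine ⟨fun α => e.symm (cls α), ⟨fun i => e.symm_apply_apply i, ?_⟩, ?_⟩
  · intro α β γ hγ
    simp only [EmbeddingLike.apply_eq_iff_eq]
    -- Otherwise both summands lie in the complement of the part of `γ`, which is closed.
    by_contra! hne
    have h1 : (α : E) ∈ P \ (cls γ : Set E) := ⟨α.2, fun h => hne.1 (huniq _ _ h).symm⟩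
    have h2 : (β : E) ∈ P \ (cls γ : Set E) := ⟨β.2, fun h => hne.2 (huniq _ _ h).symm⟩
    have h3 := (hD.inversion _ (cls γ).2).coclosed _ h1 _ h2 (hγ ▸ γ.2)
    exact h3.2 (hγ ▸ hcls γ)
  · have hclass (i : ι) : colourClass (fun α => e.symm (cls α)) i = e i := by
      ext α
      refine ⟨fun ⟨hα, h⟩ => (he ⟨α, hα⟩ i).1 h, fun h => ?_⟩
      have hα : α ∈ P := (hD.inversion _ (e i).2).subset h
      exact ⟨hα, (he ⟨α, hα⟩ i).2 h⟩
    ext Ψ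
    simp only [Set.mem_range, hclass]
    exact ⟨fun ⟨i, hi⟩ => hi ▸ (e i).2, fun h => ⟨e.symm ⟨Ψ, h⟩, by simp⟩⟩

end

theorem numFine_eq_card_rootColouring {E ι : Type*} [AddCommGroup E] [Module ℝ E] [Finite ι]
    {P : Set E} {θ : ι → P} (hrank : Module.finrank ℝ E = Nat.card ι)
    (hgen : ∀ S : Set E, (∀ i, (θ i : E) ∈ S) → IsClosedIn P S → P ⊆ S) :
    numFine P = Nat.card {κ : P → ι // IsRootColouring P θ κ} := by
  have h : Function.Bijective (fun κ : {κ : P → ι // IsRootColouring P θ κ} =>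
      (⟨Set.range (colourClass κ.1), κ.2.isDecomposition, by
        rw [hrank, ← Nat.card_coe_set_eq,
          Nat.card_range_of_injective κ.2.colourClass_injective]⟩ :
        {D : Set (Set E) | IsFineDecomposition P D})) := by
    constructor
    · intro κ κ' h
      exact Subtype.ext (κ.2.eq_of_range_eq κ'.2 (congrArg Subtype.val h))
    · rintro ⟨D, hD⟩
      obtain ⟨κ, h, h'⟩ := hD.decomposition.exists_rootColouring (hD.card.trans hrank) hgen
      exact ⟨⟨κ, h⟩, Subtype.ext h'⟩
  exact (Nat.card_congr (Equiv.ofBijective _ h)).symm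

/-! ### Counting colourings in type B -/

/-- The recursion for the numbers of fine decompositions in type `B`. -/
def fineCount : ℕ → ℕ
  | 0 => 1
  | d + 1 => ∑ x : Fin (d + 1), (if (x : ℕ) = 0 then 1 else 2) * (catalan x * fineCount (d - x))

theorem card_glueIndex_bool (x : ℕ) :
    Fintype.card {ε : Bool // ε = true → 0 < x} = if x = 0 then 1 else 2 := by
  rcases Nat.eq_zero_or_pos x with rfl | h
  · decide
  · simp [h, h.ne']

theorem sum_glueIndex (d : ℕ) (g : ℕ → ℕ) :
    ∑ x : GlueIndex d, g x.1.1 = ∑ x : Fin (d + 1), (if (x : ℕ) = 0 then 1 else 2) * g x := by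
  let e : GlueIndex d ≃ Σ x : Fin (d + 1), {ε : Bool // ε = true → 0 < x.1} :=
    { toFun x := ⟨x.1.1, x.1.2, x.2⟩
      invFun x := ⟨(x.1, x.2.1), x.2.2⟩
      left_inv _ := rfl
      right_inv _ := rfl }
  refine (Fintype.sum_equiv e (fun x => g x.1.1) (fun x => g x.1) fun _ => rfl).trans ?_
  rw [Fintype.sum_sigma]
  refine Finset.sum_congr rfl fun x _ => ?_
  change ∑ _, g x = _
  rw [Finset.sum_const, Finset.card_univ, card_glueIndex_bool, smul_eq_mul]

theorem finite_and_card_signedColouring (d : ℕ) : ∀ m : ℕ,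
    Finite (SignedColouring m (m + d)) ∧ Nat.card (SignedColouring m (m + d)) = fineCount d := by
  induction d using Nat.strong_induction_on with
  | _ d ih =>
    intro m
    cases d with
    | zero =>
      have : Unique (SignedColouring m (m + 0)) :=
        { default := ⟨⟨fun _ _ => 0, fun _ _ => 0⟩,
            ⟨fun _ _ _ => rfl, fun _ _ _ => by omega, by simp⟩, by simp, by simp, by simp, by simp⟩
          uniq := fun c => Subtype.ext (by
            refine Prod.ext ?_ ?_ <;> funext i j
            · exact c.2.interval.supp i j (by omega)
            · exact c.2.supp i j (by omega)) }
      exact ⟨inferInstance, by simp [fineCount]⟩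
    | succ d =>
      have h1 (x : GlueIndex d) := finite_and_card_intervalColouring x.1.1 m
      have h2 (x : GlueIndex d) := ih (d - x.1.1) (by omega) (m + x.1.1 + 1)
      have e (x : GlueIndex d) : m + x.1.1 + 1 + (d - x.1.1) = m + d + 1 := by omega
      simp only [e] at h2
      have f1 (x : GlueIndex d) := (h1 x).1
      have f2 (x : GlueIndex d) := (h2 x).1
      have g := Equiv.ofBijective _
        ⟨SignedColouring.glue_injective m d, SignedColouring.glue_surjective m d⟩
      refine ⟨Finite.of_equiv _ g, ?_⟩
      rw [show m + (d + 1) = m + d + 1 from rfl, ← Nat.card_congr g, Nat.card_sigma, fineCount,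
        ← sum_glueIndex d fun x => catalan x * fineCount (d - x)]
      refine Finset.sum_congr rfl fun x _ => ?_
      rw [Nat.card_prod, (h1 x).2, (h2 x).2]

theorem fineCount_succ (d : ℕ) : fineCount (d + 1) = fineCount d +
    2 * ∑ i ∈ Finset.Icc 2 (d + 1), catalan (i - 1) * fineCount (d + 1 - i) := by
  rw [fineCount, Fin.sum_univ_eq_sum_range
    (fun x => (if x = 0 then 1 else 2) * (catalan x * fineCount (d - x))) (d + 1),
    Finset.sum_range_succ', add_comm, Finset.mul_sum]
  congr 1
  · simp
  -- The index `i` of the recursion is one more than the gluing position, so `i ≥ 2` covers exactly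
  -- the positions with multiplicity `2`.
  · rw [← Finset.Ico_add_one_right_eq_Icc, Finset.sum_Ico_eq_sum_range]
    refine Finset.sum_congr (by congr 1) fun x _ => ?_
    rw [if_neg (by omega), show 2 + x - 1 = x + 1 by omega, show d + 1 - (2 + x) = d - (x + 1) by omega]

/-! ### The positive roots of `B_n` in coordinates -/

/-- The `i`-th standard unit vector for `i < n`, and `0` for `i ≥ n`. -/
noncomputable def unitVec (n i : ℕ) : EuclideanSpace ℝ (Fin n) :=
  if h : i < n then stdVec ⟨i, h⟩ else 0

variable {n : ℕ}

theorem unitVec_coe (i : Fin n) : unitVec n i = stdVec i := by simp [unitVec]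

theorem unitVec_self : unitVec n n = 0 := by simp [unitVec]

theorem unitVec_apply (i : ℕ) (x : Fin n) :
    unitVec n i x = ((if i = x then 1 else 0 : ℤ) : ℝ) := by
  unfold unitVec
  split_ifs with h1 h2 h2
  · simp [stdVec, Fin.ext_iff, h2.symm]
  · simp [stdVec, Fin.ext_iff, Ne.symm h2]
  · omega
  · simp

/-- With `unitVec n n = 0` the short roots become `e_i - e_n`, so they need no separate treatment.
-/
theorem simpleB_eq (i : Fin n) : simpleB n i = unitVec n i - unitVec n (i + 1) := by
  unfold simpleB
  split_ifs with h
  · rw [unitVec_coe, unitVec, dif_pos h]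
  · rw [unitVec_coe, show (i : ℕ) + 1 = n by omega, unitVec_self, sub_zero]

/-- The sum of the coordinates up to the `k`-th. -/
noncomputable def prefixSum (k : Fin n) : EuclideanSpace ℝ (Fin n) →+ ℝ where
  toFun α := ∑ x ∈ Finset.univ.filter (· ≤ k), α x
  map_zero' := by simp
  map_add' := by simp [Finset.sum_add_distrib]

theorem prefixSum_unitVec (k : Fin n) (i : ℕ) :
    prefixSum k (unitVec n i) = if i ≤ k then 1 else 0 := by
  by_cases h : i < n
  · have : ∀ x : Fin n, unitVec n i x = if x = ⟨i, h⟩ then 1 else 0 := fun x => by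
      rw [unitVec_apply]
      simp [Fin.ext_iff, eq_comm]
    change ∑ x ∈ Finset.univ.filter (· ≤ k), unitVec n i x = _
    simp only [this, Finset.sum_ite_eq', Finset.mem_filter, Finset.mem_univ, true_and]
    rfl
  · rw [unitVec, dif_neg h, map_zero, if_neg (by omega)]

/-- Prefix sums are `0` or `1` on simple roots. Each negative root has a negative prefix sum, so
this excludes it from `posRoots`. -/
theorem prefixSum_nonneg_of_mem {α : EuclideanSpace ℝ (Fin n)}
    (h : α ∈ posRoots (rootsB n) (simpleB n)) (k : Fin n) : 0 ≤ prefixSum k α := by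
  obtain ⟨-, d, rfl⟩ := h
  rw [map_sum]
  refine Finset.sum_nonneg fun i _ => ?_
  rw [map_nsmul, simpleB_eq, map_sub, prefixSum_unitVec, prefixSum_unitVec]
  refine nsmul_nonneg ?_ _
  split_ifs <;> first | omega | norm_num

theorem unitVec_sub_eq_sum {i j : ℕ} (hij : i ≤ j) (hj : j ≤ n) :
    ∃ d : Fin n → ℕ, unitVec n i - unitVec n j = ∑ x, d x • simpleB n x := by
  induction j, hij using Nat.le_induction with
  | base => exact ⟨0, by simp⟩
  | succ j hij ih =>
    obtain ⟨d, hd⟩ := ih (by omega)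
    refine ⟨d + Pi.single ⟨j, by omega⟩ 1, ?_⟩
    have : ∑ x, (Pi.single (⟨j, by omega⟩ : Fin n) 1 : Fin n → ℕ) x • simpleB n x =
        simpleB n ⟨j, by omega⟩ := by
      rw [Finset.sum_eq_single ⟨j, by omega⟩] <;> simp +contextual
    simp only [Pi.add_apply, add_smul, Finset.sum_add_distrib, this, ← hd]
    rw [simpleB_eq, sub_add_sub_cancel]

theorem sub_mem_posRoots {i j : ℕ} (hij : i < j) (hj : j ≤ n) :
    unitVec n i - unitVec n j ∈ posRoots (rootsB n) (simpleB n) := by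
  refine ⟨?_, unitVec_sub_eq_sum hij.le hj⟩
  rcases hj.eq_or_lt with rfl | hj
  · exact Or.inl ⟨⟨i, hij⟩, Or.inl (by rw [unitVec_self, sub_zero, ← unitVec_coe])⟩
  · exact Or.inr ⟨⟨i, by omega⟩, ⟨j, hj⟩, by simp; omega,
      Or.inr (Or.inl (by simp only [← unitVec_coe]))⟩

theorem add_mem_posRoots {i j : ℕ} (hij : i ≠ j) (hi : i < n) (hj : j < n) :
    unitVec n i + unitVec n j ∈ posRoots (rootsB n) (simpleB n) := by
  refine ⟨Or.inr ⟨⟨i, hi⟩, ⟨j, hj⟩, by simpa using hij,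
    Or.inl (by simp only [← unitVec_coe])⟩, ?_⟩
  obtain ⟨d, hd⟩ := unitVec_sub_eq_sum hi.le le_rfl
  obtain ⟨d', hd'⟩ := unitVec_sub_eq_sum hj.le le_rfl
  rw [unitVec_self, sub_zero] at hd hd'
  exact ⟨d + d', by simp [hd, hd', add_smul, Finset.sum_add_distrib]⟩

theorem mem_posRoots_iff {α : EuclideanSpace ℝ (Fin n)} :
    α ∈ posRoots (rootsB n) (simpleB n) ↔
      (∃ i j, i < j ∧ j ≤ n ∧ α = unitVec n i - unitVec n j) ∨
        ∃ i j, i < j ∧ j < n ∧ α = unitVec n i + unitVec n j := by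
  constructor
  · intro h
    have hpos := prefixSum_nonneg_of_mem h
    obtain ⟨⟨i, rfl | rfl⟩ | ⟨i, j, hij, rfl | rfl | rfl⟩, -⟩ := h
    · exact Or.inl ⟨i, n, i.2, le_rfl, by rw [unitVec_self, sub_zero, unitVec_coe]⟩
    · have := hpos i
      rw [← unitVec_coe, map_neg, prefixSum_unitVec, if_pos le_rfl] at this
      norm_num at this
    · rcases Ne.lt_or_gt hij with h | h
      · exact Or.inr ⟨i, j, h, j.2, by simp only [unitVec_coe]⟩
      · exact Or.inr ⟨j, i, h, i.2, by simp only [unitVec_coe, add_comm]⟩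
    · rcases Ne.lt_or_gt hij with h | h
      · exact Or.inl ⟨i, j, h, j.2.le, by simp only [unitVec_coe]⟩
      · have := hpos j
        rw [← unitVec_coe, ← unitVec_coe, map_sub, prefixSum_unitVec, prefixSum_unitVec,
          if_pos le_rfl, if_neg (not_le.2 (Fin.lt_def.1 h))] at this
        norm_num at this
    · have := hpos i
      rw [← unitVec_coe, ← unitVec_coe, map_sub, map_neg, prefixSum_unitVec, prefixSum_unitVec,
        if_pos le_rfl] at this
      split_ifs at this <;> norm_num at this
  · rintro (⟨i, j, hij, hj, rfl⟩ | ⟨i, j, hij, hj, rfl⟩)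
    · exact sub_mem_posRoots hij hj
    · exact add_mem_posRoots hij.ne (hij.trans hj) hj

theorem posRoots_subset_of_isClosedIn (S : Set (EuclideanSpace ℝ (Fin n)))
    (hS : ∀ i, simpleB n i ∈ S) (hcl : IsClosedIn (posRoots (rootsB n) (simpleB n)) S) :
    posRoots (rootsB n) (simpleB n) ⊆ S := by
  have hsub {i j : ℕ} (hij : i < j) (hj : j ≤ n) : unitVec n i - unitVec n j ∈ S := by
    induction j, hij using Nat.le_induction with
    | base => exact simpleB_eq (⟨i, hj⟩ : Fin n) ▸ hS ⟨i, hj⟩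
    | succ j hij ih =>
      have h1 := hS ⟨j, hj⟩
      rw [simpleB_eq] at h1
      have := hcl _ (ih (by omega)) _ h1
      rw [sub_add_sub_cancel] at this
      exact this (sub_mem_posRoots (show i < j + 1 by omega) hj)
  intro α hα
  rcases mem_posRoots_iff.1 hα with ⟨i, j, hij, hj, rfl⟩ | ⟨i, j, hij, hj, rfl⟩
  · exact hsub hij hj
  · have := hcl _ (hsub (hij.trans hj) le_rfl) _ (hsub hj le_rfl)
    rw [unitVec_self, sub_zero, sub_zero] at this
    exact this hα

/-! ### Which sums of positive roots are positive roots -/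

theorem coord_eq_of_eq {i j k l a b : ℕ} {s₁ s₂ s₃ s₄ s₅ s₆ : ℤ}
    (h : s₁ • unitVec n i + s₂ • unitVec n j + (s₃ • unitVec n k + s₄ • unitVec n l) =
      s₅ • unitVec n a + s₆ • unitVec n b) (x : ℕ) (hx : x < n) :
    s₁ * (if i = x then 1 else 0) + s₂ * (if j = x then 1 else 0) +
      (s₃ * (if k = x then 1 else 0) + s₄ * (if l = x then 1 else 0)) =
      s₅ * (if a = x then 1 else 0) + s₆ * (if b = x then 1 else 0) := by
  have := congrArg (fun α : EuclideanSpace ℝ (Fin n) => α ⟨x, hx⟩) h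
  simp only [PiLp.add_apply, PiLp.smul_apply, unitVec_apply, zsmul_eq_mul] at this
  exact_mod_cast this

theorem sub_add_sub_eq_sub {i j k l a b : ℕ} (hij : i < j) (hj : j ≤ n) (hkl : k < l) (hl : l ≤ n)
    (hab : a < b) (hb : b ≤ n)
    (h : unitVec n i - unitVec n j + (unitVec n k - unitVec n l) = unitVec n a - unitVec n b) :
    (j = k ∧ i = a ∧ l = b) ∨ (l = i ∧ k = a ∧ j = b) := by
  have := coord_eq_of_eq (n := n) (i := i) (j := j) (k := k) (l := l) (a := a) (b := b)
    (s₁ := 1) (s₂ := -1) (s₃ := 1) (s₄ := -1) (s₅ := 1) (s₆ := -1) (by simpa [sub_eq_add_neg] using h)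
  have h1 := this i
  have h2 := this j
  have h3 := this k
  have h4 := this l
  have h5 := this a
  have h6 := this b
  clear this h
  grind (splits := 20)

theorem sub_add_sub_eq_add {i j k l a b : ℕ} (hij : i < j) (hj : j ≤ n) (hkl : k < l) (hl : l ≤ n)
    (hab : a < b) (hb : b < n)
    (h : unitVec n i - unitVec n j + (unitVec n k - unitVec n l) = unitVec n a + unitVec n b) :
    j = n ∧ l = n ∧ ((i = a ∧ k = b) ∨ (i = b ∧ k = a)) := by
  have := coord_eq_of_eq (n := n) (i := i) (j := j) (k := k) (l := l) (a := a) (b := b)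
    (s₁ := 1) (s₂ := -1) (s₃ := 1) (s₄ := -1) (s₅ := 1) (s₆ := 1) (by simpa [sub_eq_add_neg] using h)
  have h1 := this i
  have h2 := this j
  have h3 := this k
  have h4 := this l
  have h5 := this a
  have h6 := this b
  clear this h
  grind

theorem sub_add_add_eq_add {i j k l a b : ℕ} (hij : i < j) (hj : j ≤ n) (hkl : k < l) (hl : l < n)
    (hab : a < b) (hb : b < n)
    (h : unitVec n i - unitVec n j + (unitVec n k + unitVec n l) = unitVec n a + unitVec n b) :
    (j = k ∧ ((i = a ∧ l = b) ∨ (i = b ∧ l = a))) ∨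
      (j = l ∧ ((i = a ∧ k = b) ∨ (i = b ∧ k = a))) := by
  have := coord_eq_of_eq (n := n) (i := i) (j := j) (k := k) (l := l) (a := a) (b := b)
    (s₁ := 1) (s₂ := -1) (s₃ := 1) (s₄ := 1) (s₅ := 1) (s₆ := 1) (by simpa [sub_eq_add_neg] using h)
  have h1 := this i
  have h2 := this j
  have h3 := this k
  have h4 := this l
  have h5 := this a
  have h6 := this b
  clear this h
  grind

theorem sub_add_add_ne_sub {i j k l a b : ℕ} (hij : i < j) (hkl : k < l) (hl : l < n) (hab : a < b) :
    unitVec n i - unitVec n j + (unitVec n k + unitVec n l) ≠ unitVec n a - unitVec n b := by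
  intro h
  have := coord_eq_of_eq (n := n) (i := i) (j := j) (k := k) (l := l) (a := a) (b := b)
    (s₁ := 1) (s₂ := -1) (s₃ := 1) (s₄ := 1) (s₅ := 1) (s₆ := -1) (by simpa [sub_eq_add_neg] using h)
  have h1 := this i
  have h2 := this j
  have h3 := this k
  have h4 := this l
  have h5 := this a
  have h6 := this b
  clear this h
  grind (splits := 20)

theorem add_add_add_ne_sub {i j k l a b : ℕ} (hij : i < j) (hj : j < n) (hkl : k < l) (hl : l < n)
    (hab : a < b) :
    unitVec n i + unitVec n j + (unitVec n k + unitVec n l) ≠ unitVec n a - unitVec n b := by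
  intro h
  have := coord_eq_of_eq (n := n) (i := i) (j := j) (k := k) (l := l) (a := a) (b := b)
    (s₁ := 1) (s₂ := 1) (s₃ := 1) (s₄ := 1) (s₅ := 1) (s₆ := -1) (by simpa [sub_eq_add_neg] using h)
  have h1 := this i
  have h2 := this j
  have h3 := this k
  have h4 := this l
  clear this h
  grind (splits := 20)

theorem add_add_add_ne_add {i j k l a b : ℕ} (hij : i < j) (hj : j < n) (hkl : k < l) (hl : l < n)
    (hab : a < b) :
    unitVec n i + unitVec n j + (unitVec n k + unitVec n l) ≠ unitVec n a + unitVec n b := by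
  intro h
  have := coord_eq_of_eq (n := n) (i := i) (j := j) (k := k) (l := l) (a := a) (b := b)
    (s₁ := 1) (s₂ := 1) (s₃ := 1) (s₄ := 1) (s₅ := 1) (s₆ := 1) (by simpa using h)
  have h1 := this i
  have h2 := this j
  have h3 := this k
  have h4 := this l
  clear this h
  grind (splits := 20)

theorem sub_eq_sub {i j k l : ℕ} (hij : i < j) (hj : j ≤ n) (hkl : k < l) (hl : l ≤ n)
    (h : unitVec n i - unitVec n j = unitVec n k - unitVec n l) : i = k ∧ j = l := by
  -- Zero coefficients reduce the four-term identity to two terms; the indices `0` are dummies.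
  have := coord_eq_of_eq (n := n) (i := i) (j := j) (k := 0) (l := 0) (a := k) (b := l)
    (s₁ := 1) (s₂ := -1) (s₃ := 0) (s₄ := 0) (s₅ := 1) (s₆ := -1) (by simpa [sub_eq_add_neg] using h)
  have h1 := this i
  have h2 := this j
  have h3 := this k
  have h4 := this l
  clear this h
  grind (splits := 20)

theorem sub_ne_add {i j k l : ℕ} (hij : i < j) (hkl : k < l) (hl : l < n) :
    unitVec n i - unitVec n j ≠ unitVec n k + unitVec n l := by
  intro h
  have := coord_eq_of_eq (n := n) (i := i) (j := j) (k := 0) (l := 0) (a := k) (b := l)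
    (s₁ := 1) (s₂ := -1) (s₃ := 0) (s₄ := 0) (s₅ := 1) (s₆ := 1) (by simpa [sub_eq_add_neg] using h)
  have h3 := this k
  have h4 := this l
  clear this h
  grind (splits := 20)

theorem add_eq_add {i j k l : ℕ} (hij : i < j) (hj : j < n) (hkl : k < l) (hl : l < n)
    (h : unitVec n i + unitVec n j = unitVec n k + unitVec n l) : i = k ∧ j = l := by
  have := coord_eq_of_eq (n := n) (i := i) (j := j) (k := 0) (l := 0) (a := k) (b := l)
    (s₁ := 1) (s₂ := 1) (s₃ := 0) (s₄ := 0) (s₅ := 1) (s₆ := 1) (by simpa using h)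
  have h1 := this i
  have h2 := this j
  have h3 := this k
  have h4 := this l
  clear this h
  grind (splits := 20)

/-! ### Root colourings of `B_n` as signed colourings -/

/-- The set of positive roots of `B_n`. -/
abbrev posB (n : ℕ) : Set (EuclideanSpace ℝ (Fin n)) := posRoots (rootsB n) (simpleB n)

/-- The root `e_i - e_j`, where `e_n = 0`. -/
noncomputable def subRoot {i j : ℕ} (hij : i < j) (hj : j ≤ n) : posB n :=
  ⟨unitVec n i - unitVec n j, sub_mem_posRoots hij hj⟩

/-- The root `e_i + e_j`. -/
noncomputable def addRoot {i j : ℕ} (hij : i ≠ j) (hi : i < n) (hj : j < n) : posB n :=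
  ⟨unitVec n i + unitVec n j, add_mem_posRoots hij hi hj⟩

/-- The simple roots of `B_n` as positive roots. -/
noncomputable def simpleRoot (i : Fin n) : posB n :=
  ⟨simpleB n i, simpleB_eq i ▸ sub_mem_posRoots (Nat.lt_succ_self i) i.2⟩

theorem simpleRoot_eq (i : Fin n) : simpleRoot i = subRoot (Nat.lt_succ_self i) i.2 :=
  Subtype.ext (simpleB_eq i)

theorem posB_cases (α : posB n) : (∃ i j, ∃ (hij : i < j) (hj : j ≤ n), α = subRoot hij hj) ∨
    ∃ i j, ∃ (hij : i < j) (hj : j < n), α = addRoot hij.ne (hij.trans hj) hj := by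
  rcases mem_posRoots_iff.1 α.2 with ⟨i, j, hij, hj, h⟩ | ⟨i, j, hij, hj, h⟩
  · exact Or.inl ⟨i, j, hij, hj, Subtype.ext h⟩
  · exact Or.inr ⟨i, j, hij, hj, Subtype.ext h⟩

/-- The colours of the roots `e_i - e_j`. -/
noncomputable def subColour (κ : posB n → Fin n) (i j : ℕ) : ℕ :=
  if h : i < j ∧ j ≤ n then κ (subRoot h.1 h.2) else 0

/-- The colours of the roots `e_i + e_j`. -/
noncomputable def addColour (κ : posB n → Fin n) (i j : ℕ) : ℕ :=
  if h : i ≠ j ∧ i < n ∧ j < n then κ (addRoot h.1 h.2.1 h.2.2) else 0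

theorem subColour_of_lt {κ : posB n → Fin n} {i j : ℕ} (hij : i < j) (hj : j ≤ n) :
    subColour κ i j = κ (subRoot hij hj) := dif_pos ⟨hij, hj⟩

theorem addColour_of_ne {κ : posB n → Fin n} {i j : ℕ} (hij : i ≠ j) (hi : i < n) (hj : j < n) :
    addColour κ i j = κ (addRoot hij hi hj) := dif_pos ⟨hij, hi, hj⟩

theorem IsRootColouring.isSignedColouring {κ : posB n → Fin n}
    (h : IsRootColouring (posB n) simpleRoot κ) :
    IsSignedColouring 0 n (subColour κ) (addColour κ) where
  interval :=
    { supp i j hij := dif_neg (by omega)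
      simple i _ hi := by
        rw [subColour_of_lt (Nat.lt_succ_self i) hi]
        have := h.simple ⟨i, hi⟩
        rw [simpleRoot_eq] at this
        exact congrArg Fin.val this
      split i j k _ hij hjk hk := by
        rw [subColour_of_lt (hij.trans hjk) hk, subColour_of_lt hij (by omega),
          subColour_of_lt hjk hk, Fin.val_inj, Fin.val_inj]
        exact h.add _ _ _ (sub_add_sub_cancel _ _ _).symm }
  supp i j hij := dif_neg (by omega)
  symm i j := by
    by_cases hij : i ≠ j ∧ i < n ∧ j < n
    · rw [addColour_of_ne hij.1 hij.2.1 hij.2.2, addColour_of_ne hij.1.symm hij.2.2 hij.2.1]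
      exact congrArg (fun α => (κ α : ℕ)) (Subtype.ext (add_comm _ _))
    · rw [addColour, dif_neg hij, addColour, dif_neg (by omega)]
  short i j _ hi _ hj hij := by
    rw [addColour_of_ne hij hi hj, subColour_of_lt hi le_rfl, subColour_of_lt hj le_rfl,
      Fin.val_inj, Fin.val_inj]
    exact h.add _ _ _ (by simp [addRoot, subRoot, unitVec_self])
  long i j k _ hik hk _ hj hji hjk := by
    rw [addColour_of_ne hji.symm (hik.trans hk) hj, subColour_of_lt hik hk.le,
      addColour_of_ne hjk.symm hk hj, Fin.val_inj, Fin.val_inj]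
    exact h.add _ _ _ (by simp only [addRoot, subRoot]; abel)

/-- A colouring of the positive roots is determined by its values. -/
theorem eq_of_colours_eq {κ κ' : posB n → Fin n} (h : subColour κ = subColour κ')
    (h' : addColour κ = addColour κ') : κ = κ' := by
  funext α
  apply Fin.ext
  rcases posB_cases α with ⟨i, j, hij, hj, rfl⟩ | ⟨i, j, hij, hj, rfl⟩
  · rw [← subColour_of_lt, ← subColour_of_lt, h]
  · rw [← addColour_of_ne, ← addColour_of_ne, h']

theorem IsSignedColouring.exists_colours {u v : ℕ → ℕ → ℕ} (h : IsSignedColouring 0 n u v) :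
    ∃ κ : posB n → Fin n, (∀ i j (hij : i < j) (hj : j ≤ n), κ (subRoot hij hj) = u i j) ∧
      ∀ i j (hij : i ≠ j) (hi : i < n) (hj : j < n), κ (addRoot hij hi hj) = v i j := by
  have hu {i j : ℕ} (hij : i < j) (hj : j ≤ n) : u i j < n :=
    (h.interval.bounds (Nat.zero_le i) hij hj).2.trans_le hj
  have hv {i j : ℕ} (hij : i < j) (hj : j < n) : v i j < n := by
    rcases h.short i j (by omega) (by omega) (by omega) hj hij.ne with e | e <;> rw [e] <;>
      exact hu (by omega) le_rfl
  -- With `i < j` the expression of a root is unique, so the colour is well defined; the other order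
  -- of `e_i + e_j` is covered by `symm` afterwards.
  have hex (α : posB n) : ∃ c : Fin n,
      (∀ i j (hij : i < j) (hj : j ≤ n), α = subRoot hij hj → c = u i j) ∧
      ∀ i j (hij : i < j) (hj : j < n), α = addRoot hij.ne (hij.trans hj) hj → c = v i j := by
    rcases posB_cases α with ⟨i, j, hij, hj, rfl⟩ | ⟨i, j, hij, hj, rfl⟩
    · refine ⟨⟨u i j, hu hij hj⟩, fun a b hab hb e => ?_, fun a b hab hb e => ?_⟩
      · obtain ⟨rfl, rfl⟩ := sub_eq_sub hij hj hab hb (congrArg Subtype.val e)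
        rfl
      · exact (sub_ne_add hij hab hb (congrArg Subtype.val e)).elim
    · refine ⟨⟨v i j, hv hij hj⟩, fun a b hab hb e => ?_, fun a b hab hb e => ?_⟩
      · exact (sub_ne_add hab hij hj (congrArg Subtype.val e).symm).elim
      · obtain ⟨rfl, rfl⟩ := add_eq_add hij hj hab hb (congrArg Subtype.val e)
        rfl
  choose κ hκ hκ' using hex
  refine ⟨κ, fun i j hij hj => hκ _ i j hij hj rfl, fun i j hij hi hj => ?_⟩
  rcases hij.lt_or_gt with hlt | hlt
  · exact hκ' _ i j hlt hj rfl
  · rw [h.symm]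
    exact hκ' _ j i hlt hi (Subtype.ext (add_comm _ _))

theorem IsSignedColouring.exists_rootColouring {u v : ℕ → ℕ → ℕ}
    (h : IsSignedColouring 0 n u v) : ∃ κ : posB n → Fin n,
      IsRootColouring (posB n) simpleRoot κ ∧ subColour κ = u ∧ addColour κ = v := by
  obtain ⟨κ, hu, hv⟩ := h.exists_colours
  refine ⟨κ, ⟨fun i => Fin.ext ?_, fun α β γ hγ => ?_⟩, ?_, ?_⟩
  · rw [simpleRoot_eq, hu]
    exact h.interval.simple i (by omega) i.2
  · simp only [← Fin.val_inj]
    -- Of the eight sign patterns, differences summing to a difference use `split`, two short roots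
    -- use `short`, and a difference plus a sum uses `long`. The other patterns cannot occur.
    rcases posB_cases α with ⟨i, j, hij, hj, rfl⟩ | ⟨i, j, hij, hj, rfl⟩ <;>
    rcases posB_cases β with ⟨k, l, hkl, hl, rfl⟩ | ⟨k, l, hkl, hl, rfl⟩ <;>
    rcases posB_cases γ with ⟨a, b, hab, hb, rfl⟩ | ⟨a, b, hab, hb, rfl⟩ <;>
    simp only [hu, hv] <;> replace hγ := hγ.symm
    · have := h.interval.split a j b
      have := h.interval.split a l b
      have := sub_add_sub_eq_sub hij hj hkl hl hab hb hγ
      grind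
    · have := h.short a b
      have := sub_add_sub_eq_add hij hj hkl hl hab hb hγ
      grind
    · exact (sub_add_add_ne_sub hij hkl hl hab hγ).elim
    · have := h.long i k j
      have := h.long i l j
      have := h.symm a b
      have := h.symm k l
      have := sub_add_add_eq_add hij hj hkl hl hab hb hγ
      grind
    · exact (sub_add_add_ne_sub hkl hij hj hab ((add_comm _ _).trans hγ)).elim
    · have := h.long k i l
      have := h.long k j l
      have := h.symm a b
      have := h.symm i j
      have := sub_add_add_eq_add hkl hl hij hj hab hb ((add_comm _ _).trans hγ)
      grind
    · exact (add_add_add_ne_sub hij hj hkl hl hab hγ).elim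
    · exact (add_add_add_ne_add hij hj hkl hl hab hγ).elim
  · funext i j
    by_cases hij : i < j ∧ j ≤ n
    · rw [subColour_of_lt hij.1 hij.2, hu]
    · rw [subColour, dif_neg hij, h.interval.supp i j (by omega)]
  · funext i j
    by_cases hij : i ≠ j ∧ i < n ∧ j < n
    · rw [addColour_of_ne hij.1 hij.2.1 hij.2.2, hv]
    · rw [addColour, dif_neg hij, h.supp i j (by omega)]

theorem b_eq_fineCount (n : ℕ) : b n = fineCount n := by
  have hb : b n = Nat.card {κ : posB n → Fin n // IsRootColouring (posB n) simpleRoot κ} :=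
    numFine_eq_card_rootColouring (by simp) fun S hS hcl => posRoots_subset_of_isClosedIn S hS hcl
  have hbij : Function.Bijective
      (fun κ : {κ : posB n → Fin n // IsRootColouring (posB n) simpleRoot κ} =>
        (⟨(subColour κ.1, addColour κ.1), κ.2.isSignedColouring⟩ : SignedColouring 0 n)) := by
    constructor
    · intro κ κ' e
      have e := Prod.ext_iff.1 (congrArg Subtype.val e)
      exact Subtype.ext (eq_of_colours_eq e.1 e.2)
    · rintro ⟨⟨u, v⟩, h⟩
      obtain ⟨κ, hκ, rfl, rfl⟩ := h.exists_rootColouring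
      exact ⟨⟨κ, hκ⟩, rfl⟩
  rw [hb, Nat.card_congr (Equiv.ofBijective _ hbij), ← (finite_and_card_signedColouring n 0).2,
    Nat.zero_add]

end FineDecomposition

theorem mainTheorem8 :
    (∀ n : ℕ, 1 ≤ n →
      FineDecomposition.b n = FineDecomposition.b (n - 1) +
        2 * ∑ i ∈ Finset.Icc 2 n, catalan (i - 1) * FineDecomposition.b (n - i)) ∧
    FineDecomposition.b 0 = 1 ∧
    FineDecomposition.b 1 = 1 ∧
    FineDecomposition.b 2 = 3 ∧
    FineDecomposition.b 3 = 9 ∧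
    FineDecomposition.b 4 = 29 ∧
    FineDecomposition.b 5 = 97 ∧
    FineDecomposition.b 6 = 333 ∧
    FineDecomposition.b 7 = 1165 := by
  simp only [FineDecomposition.b_eq_fineCount]
  refine ⟨fun n hn => ?_, ?_⟩
  · obtain ⟨d, rfl⟩ : ∃ d, n = d + 1 := ⟨n - 1, by omega⟩
    exact FineDecomposition.fineCount_succ d
  · simp [FineDecomposition.fineCount, Fin.sum_univ_succ, catalan_eq_centralBinom_div,
      Nat.centralBinom, Nat.choose]
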